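/- \textbf{Setting.} Let $d\ge 1$. A server has $d$ resources, each with capacity $1$. Jobs arrive according to a Poisson process of rate $\lambda>0$; their resource requirements are i.i.d. with a probability density $f_V$ on $(0,1]^d$, and their durations are i.i.d. $\mathrm{Exp}(1)$ and unobserved by the scheduler. A state is the finite list $x=(v_1,\dots,v_N)$, $N\ge 0$, of the requirements of the jobs present, ordered by arrival. A (Markovian, preemptive) policy assigns to each state $x$ a set $\pi(x)$ of jobs of $x$ whose total requirement of each resource is at most $1$ (measurably in $x$); each job in $\pi(x)$ leaves at rate $1$ and new jobs join the end of the list at rate $\lambda$. This defines a Markov jump process on the set of states. The system is \emph{stable} under $\pi$ if the empty state is positive recurrent, i.e. the mean return time to the empty state of the process started there is finite. \textbf{Discretization.} Fix $\vec K=(K_1,\dots,K_d)$ with integers $K_l\ge 1$. Let $\Gamma_{\vec K}=\{\vec i\in\mathbb N^d: 1\le i_l\le K_l \text{ for all } l\}$. A job is of type $\vec i$ if its requirement lies in $I_{\vec i}=\prod_{l=1}^d\big(\tfrac{i_l-1}{K_l},\tfrac{i_l}{K_l}\big]$, and $q_{\vec i}(x)$ denotes the number of type-$\vec i$ jobs in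 state $x$. The set of admissible service options is \[ C_{\vec K}=\Big\{M\in\mathbb N^{\Gamma_{\vec K}}:\ \sum_{\vec i\in\Gamma_{\vec K}} i_l\,M^{(\vec i)}\le K_l\ \text{ for all } 1\le l\le d\Big\}. \] For $E_{\vec K}\subseteq C_{\vec K}$, a \emph{$\vec K$-EMW policy with efficient set $E_{\vec K}$} chooses in a state with type counts $q$ an option $M(q)\in\arg\max_{M\in E_{\vec K}}\langle M,q\rangle$ (ties broken arbitrarily as a function of $q$) and serves exactly $\min\{M(q)^{(\vec i)},q_{\vec i}\}$ of the type-$\vec i$ jobs present, for each $\vec i$. A \emph{$\vec K$-MW policy} is the case $E_{\vec K}=C_{\vec K}$. Put $\eta^A_{\vec K}(\vec i)=\int_{I_{\vec i}}\lambda f_V(x)\,dx$ and, for a probability distribution $\beta_{\vec K}$ on $C_{\vec K}$, $\eta^S_{\vec K}(\vec i)=\sum_{M\in C_{\vec K}}\beta_{\vec K}(M)\,M^{(\vec i)}$. \textbf{Lemma (sufficient stability condition).} (1) If there is a probability distribution $\beta_{\vec K}$ on $C_{\vec K}$ with \[ \eta^S_{\vec K}(\vec i)>\eta^A_{\vec K}(\vec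 i)\qquad\text{for all } \vec i\in\Gamma_{\vec K}, \tag{$*$} \] then the system is stable under every $\vec K$-MW policy. (2) For every $E_{\vec K}\subseteq C_{\vec K}$: if there is a probability distribution $\beta_{\vec K}$ on $C_{\vec K}$ whose support is contained in $E_{\vec K}$ and which satisfies $(*)$, then the system is stable under every $\vec K$-EMW policy with efficient set $E_{\vec K}$. -/

import Mathlib

open MeasureTheory ProbabilityTheory
open scoped ENNReal

noncomputable section

namespace MRJ

/-! ## The continuous multiresource-job (MRJ) system -/

/-- Resource requirements: the box `(0,1]^d`. -/
abbrev Req (d : ℕ) : Type := {v : Fin d → ℝ // ∀ l, 0 < v l ∧ v l ≤ 1}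

/-- Lebesgue measure on the box `(0,1]^d`. -/
def boxVolume (d : ℕ) : Measure (Req d) :=
  (volume : Measure (Fin d → ℝ)).comap Subtype.val

/-- Data of the model: a Poisson arrival rate `lam > 0` and the probability density on `(0,1]^d`
of the i.i.d. resource requirements. Job durations are `Exp(1)`. -/
structure Model (d : ℕ) where
  lam : ℝ
  lam_pos : 0 < lam
  density : Req d → ℝ
  measurable_density : Measurable density
  density_nonneg : ∀ v, 0 ≤ density v
  lintegral_density : ∫⁻ v, ENNReal.ofReal (density v) ∂(boxVolume d) = 1

/-- The law of a resource requirement. -/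
def Model.reqLaw {d : ℕ} (S : Model d) : Measure (Req d) :=
  (boxVolume d).withDensity fun v => ENNReal.ofReal (S.density v)

instance {d : ℕ} (S : Model d) : IsProbabilityMeasure S.reqLaw :=
  ⟨by rw [Model.reqLaw, withDensity_apply _ MeasurableSet.univ, Measure.restrict_univ,
    S.lintegral_density]⟩

/-- States: finite lists of the requirements of the jobs in the system, in order of arrival
(a smaller index means an earlier arrival). -/
abbrev State (d : ℕ) : Type := Σ N : ℕ, (Fin N → Req d)

/-- The empty system. -/
def emptyState (d : ℕ) : State d := ⟨0, Fin.elim0⟩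

/-- A job with requirement `w` joins the end of the list. -/
def arrive {d : ℕ} (x : State d) (w : Req d) : State d :=
  ⟨x.1 + 1, Fin.snoc (α := fun _ => Req d) x.2 w⟩

/-- The job at position `n` leaves; the order of the other jobs is kept. -/
def depart {d : ℕ} : (x : State d) → Fin x.1 → State d
  | ⟨0, _⟩, n => n.elim0
  | ⟨N + 1, v⟩, n => ⟨N, n.removeNth v⟩

/-- A Markovian policy: it maps each state to a set of jobs that fits into the server, whose
capacity of each resource is `1`. -/
structure Policy (d : ℕ) where
  served : (x : State d) → Finset (Fin x.1)
  capacity : ∀ (x : State d) (l : Fin d), ∑ n ∈ served x, (x.2 n).1 l ≤ 1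
  measurable_served : ∀ (N : ℕ) (n : Fin N),
    MeasurableSet {v : Fin N → Req d | n ∈ served ⟨N, v⟩}

/-! ### The Markov jump process

In state `x` a job with requirement of law `reqLaw` arrives at rate `lam`, and every job in
service leaves at rate `1`. The process is given by its jump chain and its holding times. -/

/-- Total jump rate out of `x`. -/
def jumpRate {d : ℕ} (S : Model d) (p : Policy d) (x : State d) : ℝ :=
  S.lam + (p.served x).card

/-- Law of the next state after a jump out of `x`: each transition has probability proportional
to its rate. -/
def jumpLaw {d : ℕ} (S : Model d) (p : Policy d) (x : State d) : Measure (State d) :=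
  ENNReal.ofReal (S.lam / jumpRate S p x) • S.reqLaw.map (arrive x)
    + ∑ n ∈ p.served x, ENNReal.ofReal (1 / jumpRate S p x) • Measure.dirac (depart x n)

lemma jumpRate_pos {d : ℕ} (S : Model d) (p : Policy d) (x : State d) : 0 < jumpRate S p x :=
  add_pos_of_pos_of_nonneg S.lam_pos (Nat.cast_nonneg _)

lemma measurable_state_iff {d : ℕ} {β : Type*} [MeasurableSpace β] (f : State d → β) :
    Measurable f ↔ ∀ N : ℕ, Measurable fun v : Fin N → Req d => f ⟨N, v⟩ := by
  constructor
  · intro h N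
    refine h.comp ?_
    intro s hs
    exact MeasurableSpace.measurableSet_iInf.1 hs N
  · intro h s hs
    exact MeasurableSpace.measurableSet_iInf.2 fun N => h N hs

lemma measurable_stateMk {d : ℕ} (N : ℕ) :
    Measurable (fun v : Fin N → Req d => (⟨N, v⟩ : State d)) :=
  (measurable_state_iff id).1 measurable_id N

lemma measurable_arrive_uncurry {d : ℕ} (N : ℕ) :
    Measurable (fun z : (Fin N → Req d) × Req d => arrive ⟨N, z.1⟩ z.2) := by
  refine (measurable_stateMk (N + 1)).comp (measurable_pi_lambda _ fun n => ?_)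
  refine Fin.lastCases ?_ (fun m => ?_) n
  · simpa using measurable_snd
  · simpa using! (measurable_pi_apply m).comp (measurable_fst (α := Fin N → Req d) (β := Req d))

lemma measurable_arrive {d : ℕ} (x : State d) : Measurable (arrive x) :=
  (measurable_arrive_uncurry x.1).comp (measurable_const.prodMk measurable_id)

lemma measurable_depart {d : ℕ} (N : ℕ) (n : Fin N) :
    Measurable (fun v : Fin N → Req d => depart ⟨N, v⟩ n) := by
  cases N with
  | zero => exact n.elim0
  | succ N =>
    exact (measurable_stateMk N).comp
      (measurable_pi_lambda _ fun m => measurable_pi_apply (n.succAbove m))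

lemma measurable_card {d : ℕ} (p : Policy d) :
    Measurable fun x : State d => (p.served x).card := by
  classical
  refine (measurable_state_iff _).2 fun N => ?_
  have h : (fun v : Fin N → Req d => (p.served ⟨N, v⟩).card)
      = fun v => ∑ n : Fin N, if n ∈ p.served ⟨N, v⟩ then 1 else 0 := by
    funext v
    simp
  rw [h]
  exact Finset.measurable_sum _ fun n _ =>
    Measurable.ite (p.measurable_served N n) measurable_const measurable_const

lemma measurable_jumpRate {d : ℕ} (S : Model d) (p : Policy d) : Measurable (jumpRate S p) :=
  measurable_const.add ((measurable_from_top (f := fun n : ℕ => (n : ℝ))).comp (measurable_card p))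

lemma measurable_jumpLaw {d : ℕ} (S : Model d) (p : Policy d) : Measurable (jumpLaw S p) := by
  classical
  refine Measure.measurable_of_measurable_coe _ fun s hs => ?_
  refine (measurable_state_iff _).2 fun N => ?_
  have hr : Measurable fun v : Fin N → Req d => jumpRate S p ⟨N, v⟩ :=
    (measurable_jumpRate S p).comp (measurable_stateMk N)
  have h : (fun v : Fin N → Req d => jumpLaw S p ⟨N, v⟩ s) = fun v =>
      ENNReal.ofReal (S.lam / jumpRate S p ⟨N, v⟩)
          * S.reqLaw (Prod.mk v ⁻¹'
            ((fun z : (Fin N → Req d) × Req d => arrive ⟨N, z.1⟩ z.2) ⁻¹' s))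
        + ∑ n : Fin N, if n ∈ p.served ⟨N, v⟩ then
            ENNReal.ofReal (1 / jumpRate S p ⟨N, v⟩) * s.indicator 1 (depart ⟨N, v⟩ n)
          else 0 := by
    funext v
    simp only [jumpLaw, Measure.add_apply, Measure.smul_apply, smul_eq_mul,
      Measure.finsetSum_apply, Measure.map_apply (measurable_arrive _) hs, Measure.dirac_apply' _ hs,
      Finset.sum_ite_mem, Finset.univ_inter]
    rfl
  rw [h]
  refine Measurable.add ?_ (Finset.measurable_sum _ fun n _ => ?_)
  · exact (measurable_const.div hr).ennreal_ofReal.mul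
      (measurable_measure_prodMk_left (measurable_arrive_uncurry N hs))
  · refine Measurable.ite (p.measurable_served N n) ?_ measurable_const
    exact (measurable_const.div hr).ennreal_ofReal.mul
      ((measurable_one.indicator hs).comp (measurable_depart N n))

/-- Transition kernel of the jump chain. -/
def jumpKernel {d : ℕ} (S : Model d) (p : Policy d) : Kernel (State d) (State d) where
  toFun := jumpLaw S p
  measurable' := measurable_jumpLaw S p

instance {d : ℕ} (S : Model d) (p : Policy d) : IsMarkovKernel (jumpKernel S p) := by
  refine ⟨fun x => ⟨?_⟩⟩
  have hr := jumpRate_pos S p x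
  change jumpLaw S p x Set.univ = 1
  simp only [jumpLaw, Measure.add_apply, Measure.smul_apply, smul_eq_mul,
    Measure.finsetSum_apply, Measure.map_apply (measurable_arrive _) MeasurableSet.univ,
    Set.preimage_univ, measure_univ, mul_one, Finset.sum_const, nsmul_eq_mul]
  rw [← ENNReal.ofReal_natCast, ← ENNReal.ofReal_mul (Nat.cast_nonneg _),
    ← ENNReal.ofReal_add (div_nonneg S.lam_pos.le hr.le) (by positivity),
    ← ENNReal.ofReal_one]
  congr 1
  have h : S.lam + ((p.served x).card : ℝ) ≠ 0 := hr.ne'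
  unfold jumpRate
  field_simp

/-- The holding time in `x` is exponential with parameter the total jump rate out of `x`. -/
def holdingKernel {d : ℕ} (S : Model d) (p : Policy d) : Kernel (State d) ℝ :=
  (Kernel.ofFunOfCountable fun k : ℕ => expMeasure (S.lam + k)).comap
    (fun x : State d => (p.served x).card) (measurable_card p)

lemma holdingKernel_apply {d : ℕ} (S : Model d) (p : Policy d) (x : State d) :
    holdingKernel S p x = expMeasure (jumpRate S p x) := rfl

instance {d : ℕ} (S : Model d) (p : Policy d) : IsMarkovKernel (holdingKernel S p) :=
  ⟨fun x => isProbabilityMeasure_expMeasure (jumpRate_pos S p x)⟩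

/-- A visited state together with its holding time. -/
def visitKernel {d : ℕ} (S : Model d) (p : Policy d) : Kernel (State d) (State d × ℝ) :=
  Kernel.id ×ₖ holdingKernel S p

instance {d : ℕ} (S : Model d) (p : Policy d) : IsMarkovKernel (visitKernel S p) := by
  unfold visitKernel; infer_instance

/-- From the `k`-th visited state, jump and draw the holding time of the new state. -/
def stepKernel {d : ℕ} (S : Model d) (p : Policy d) (k : ℕ) :
    Kernel ((i : Finset.Iic k) → (fun _ : ℕ => State d × ℝ) i) (State d × ℝ) :=
  (visitKernel S p ∘ₖ jumpKernel S p).comap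
    (fun h => (h ⟨k, Finset.mem_Iic.2 le_rfl⟩).1)
    (measurable_fst.comp (measurable_pi_apply _))

instance {d : ℕ} (S : Model d) (p : Policy d) (k : ℕ) : IsMarkovKernel (stepKernel S p k) := by
  unfold stepKernel; infer_instance

/-- Law, for the process started in `x`, of the sequence `ω`, where `(ω k).1` is the `k`-th
visited state and `(ω k).2` the time spent there. -/
def pathLaw {d : ℕ} (S : Model d) (p : Policy d) (x : State d) : Measure (ℕ → State d × ℝ) :=
  Kernel.trajMeasure (X := fun _ => State d × ℝ) (visitKernel S p x) (stepKernel S p)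

/-- Time of the `k`-th jump. -/
def jumpTime {d : ℕ} (ω : ℕ → State d × ℝ) (k : ℕ) : ℝ≥0∞ :=
  ∑ j ∈ Finset.range k, ENNReal.ofReal (ω j).2

/-- First time, at or after the first jump, at which the process is in state `x`
(`∞` if there is none). -/
def returnTime {d : ℕ} (x : State d) (ω : ℕ → State d × ℝ) : ℝ≥0∞ :=
  sInf {t | ∃ k : ℕ, 1 ≤ k ∧ (ω k).1 = x ∧ t = jumpTime ω k}

/-- Positive recurrence of a state: the mean return time is finite. -/
def PositiveRecurrent {d : ℕ} (S : Model d) (p : Policy d) (x : State d) : Prop :=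
  ∫⁻ ω, returnTime x ω ∂(pathLaw S p x) < ∞

/-- The system is stable under the policy `p` if the empty state is positive recurrent. -/
def IsStable {d : ℕ} (S : Model d) (p : Policy d) : Prop :=
  PositiveRecurrent S p (emptyState d)

/-! ## The `K`-discretization -/

/-- The set `Γ_K` of job types: `i ∈ ℕ^d` with `1 ≤ i_l ≤ K_l` for all `l`. -/
abbrev JobType {d : ℕ} (K : Fin d → ℕ) : Type := Finset.Icc (1 : Fin d → ℕ) K

/-- The bucket `I_i = ∏_l ((i_l - 1)/K_l, i_l/K_l]`. -/
def bucket {d : ℕ} (K : Fin d → ℕ) (i : JobType K) : Set (Req d) :=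
  {v | ∀ l, ((i.1 l : ℝ) - 1) / K l < v.1 l ∧ v.1 l ≤ (i.1 l : ℝ) / K l}

open Classical in
/-- Among the jobs of `x` with index in `s`, the number of those of type `i`. -/
def typeCount {d : ℕ} (K : Fin d → ℕ) (x : State d) (s : Finset (Fin x.1)) (i : JobType K) : ℕ :=
  (s.filter fun n => x.2 n ∈ bucket K i).card

/-- `q_i(x)`: the number of type-`i` jobs in the system. -/
def queue {d : ℕ} (K : Fin d → ℕ) (x : State d) (i : JobType K) : ℕ :=
  typeCount K x Finset.univ i

/-- The set `C_K` of admissible service options. -/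
def serviceOptions {d : ℕ} (K : Fin d → ℕ) : Set (JobType K → ℕ) :=
  {M | ∀ l, ∑ i : JobType K, i.1 l * M i ≤ K l}

/-- `⟨M, q⟩`. -/
def weight {d : ℕ} {K : Fin d → ℕ} (M q : JobType K → ℕ) : ℕ := ∑ i, M i * q i

/-- `p` is a `K`-discretized efficient MaxWeight policy with efficient set `E`: it chooses as a
function of the type counts `q` an option `M(q) ∈ E` which maximizes `⟨M, q⟩` over `E` (ties may
be broken in any way), and serves as many jobs of each type `i` as `M(q)` attempts to serve and
as are present. -/
def IsEMW {d : ℕ} (K : Fin d → ℕ) (E : Set (JobType K → ℕ)) (p : Policy d) : Prop :=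
  ∃ M : (JobType K → ℕ) → (JobType K → ℕ),
    (∀ q, M q ∈ E ∧ ∀ M' ∈ E, weight M' q ≤ weight (M q) q) ∧
    ∀ x i, typeCount K x (p.served x) i = min (M (queue K x) i) (queue K x i)

/-- `p` is a `K`-discretized MaxWeight policy. -/
def IsMW {d : ℕ} (K : Fin d → ℕ) (p : Policy d) : Prop := IsEMW K (serviceOptions K) p

/-- The discretized arrival measure `η^A_K(i) = ∫_{I_i} λ f_V`. -/
def arrivalMeasure {d : ℕ} (S : Model d) (K : Fin d → ℕ) (i : JobType K) : ℝ :=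
  ∫ v in bucket K i, S.lam * S.density v ∂(boxVolume d)

/-- The discretized service measure `η^S_K(i) = ∑_{M ∈ C_K} β(M) M^{(i)}` induced by a service
option distribution `β` on `C_K`. -/
def serviceMeasure {d : ℕ} {K : Fin d → ℕ} (β : PMF (serviceOptions K)) (i : JobType K) : ℝ :=
  ∑' M : serviceOptions K, (β M).toReal * (M.1 i : ℝ)

end MRJ

end

noncomputable section

namespace MRJ

/-! ## A Foster criterion for the mean return time -/

/-! The proof is a Foster–Lyapunov argument with the Lyapunov function `∑ q_i ^ 2 + A * (r + r ^ 2 +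
... + r ^ N)`, where `N` is the number of jobs.

For the quadratic part, a MaxWeight choice weighs at least as much as the mean of any distribution
on the efficient set, so `⟨M(q), q⟩ ≥ ∑ η^S_i q_i ≥ ∑ (η^A_i + ε) q_i`. The generator therefore
gives at most `C - 2 ε N` (`sum_serviceMeasure_mul_le`, `quadratic_drift_le`), which is negative
only when `N` is large.

The geometric part repairs small `N`. Every nonempty state has at least one job in service: all
`η^S_i` are positive, hence the maximal weight is positive. With `λ r ≤ 1/2`, the generator takes
the geometric part down by at least `A r ^ N / 2`, and a large `A` makes this beat `C` for all small
`N`. The drift is then at most `-1` in every state but the empty one, so no separate argument is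
needed for returning to the empty state from an uncountable exceptional set.

Foster's criterion (`positiveRecurrent_of_drift`) turns this into a finite expected number of jumps
before the return. Holding times have mean at most `1/λ`, so the mean return time is finite too. -/

/-- On `t ≥ 0`, `t * r * exp (-r t)` is `1/r` times the Gamma(2, r) density, which has total mass
one. -/
lemma lintegral_ofReal_expMeasure {r : ℝ} (hr : 0 < r) :
    ∫⁻ t, ENNReal.ofReal t ∂(expMeasure r) = ENNReal.ofReal (1 / r) := by
  have h : ∀ t, exponentialPDF r t * ENNReal.ofReal t = ENNReal.ofReal (1 / r) * gammaPDF 2 r t := by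
    intro t
    rcases lt_or_ge t 0 with ht | ht
    · rw [exponentialPDF_of_neg ht, gammaPDF_of_neg ht, zero_mul, mul_zero]
    · rw [exponentialPDF_of_nonneg ht, gammaPDF_of_nonneg ht, ← ENNReal.ofReal_mul (by positivity),
        ← ENNReal.ofReal_mul (by positivity), Real.Gamma_two]
      congr 1
      norm_num
      field_simp
  have hm : Measurable (gammaPDF 2 r) := (measurable_gammaPDFReal 2 r).ennreal_ofReal
  have hm' : Measurable (exponentialPDF r) := (measurable_exponentialPDFReal r).ennreal_ofReal
  calc ∫⁻ t, ENNReal.ofReal t ∂(expMeasure r)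
      = ∫⁻ t, exponentialPDF r t * ENNReal.ofReal t :=
        lintegral_withDensity_eq_lintegral_mul _ hm' ENNReal.measurable_ofReal
    _ = ENNReal.ofReal (1 / r) := by
        simp_rw [h]
        rw [lintegral_const_mul _ hm, lintegral_gammaPDF_eq_one two_pos hr, mul_one]

variable {d : ℕ} {S : Model d} {p : Policy d}

/-! ### Conditioning along the path of the jump chain -/

lemma lintegral_visitKernel {f : State d × ℝ → ℝ≥0∞} (hf : Measurable f) (y : State d) :
    ∫⁻ z, f z ∂(visitKernel S p y) = ∫⁻ t, f (y, t) ∂(expMeasure (jumpRate S p y)) := by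
  rw [visitKernel, Kernel.lintegral_id_prod hf]
  rfl

/-- Arrivals alone make the total jump rate at least `λ`, so the bound is uniform in the state. -/
lemma lintegral_visitKernel_time_le (y : State d) :
    ∫⁻ z, (ENNReal.ofReal z.2 + 1) ∂(visitKernel S p y) ≤ ENNReal.ofReal (1 / S.lam) + 1 := by
  have hr := jumpRate_pos S p y
  have := isProbabilityMeasure_expMeasure hr
  rw [lintegral_visitKernel (by fun_prop), lintegral_add_right _ measurable_const,
    lintegral_ofReal_expMeasure hr, lintegral_one, measure_univ]
  gcongr
  · exact S.lam_pos
  · exact le_add_of_nonneg_right (Nat.cast_nonneg _)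

lemma pathLaw_map_zero (x : State d) :
    (pathLaw S p x).map (fun ω => ω 0) = visitKernel S p x := by
  have h : (pathLaw S p x).map (Preorder.frestrictLe 0) = (visitKernel S p x).map
      (MeasurableEquiv.piUnique fun _ : Finset.Iic 0 => State d × ℝ).symm := by
    rw [pathLaw, Kernel.trajMeasure, Measure.map_comp _ _ (by fun_prop),
      Kernel.traj_map_frestrictLe, Kernel.partialTraj_self, Measure.id_comp]
  have h2 := congrArg (Measure.map fun z => z ⟨0, Finset.mem_Iic.2 le_rfl⟩) h
  rw [Measure.map_map (by fun_prop) (by fun_prop), Measure.map_map (by fun_prop) (by fun_prop)]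
    at h2
  refine h2.trans ?_
  exact Measure.map_id

instance (x : State d) : IsProbabilityMeasure (pathLaw S p x) := by
  unfold pathLaw; infer_instance

/-- The Markov property: history and next visit together have the composition-product law, and the
step kernel sees only the last state of the history. -/
lemma lintegral_pathLaw_succ (x : State d) (k : ℕ)
    {g : ((i : Finset.Iic k) → (fun _ : ℕ => State d × ℝ) i) → ℝ≥0∞} (hg : Measurable g)
    {f : State d × ℝ → ℝ≥0∞} (hf : Measurable f) :
    ∫⁻ ω, g (Preorder.frestrictLe k ω) * f (ω (k + 1)) ∂(pathLaw S p x)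
      = ∫⁻ ω, g (Preorder.frestrictLe k ω)
          * ∫⁻ y, ∫⁻ z, f z ∂(visitKernel S p y) ∂(jumpKernel S p (ω k).1) ∂(pathLaw S p x) := by
  have key := Kernel.map_frestrictLe_trajMeasure_compProd_eq_map_trajMeasure
    (X := fun _ => State d × ℝ) (μ₀ := visitKernel S p x) (κ := stepKernel S p) (a := k)
  have hF : Measurable fun z : ((i : Finset.Iic k) → (fun _ : ℕ => State d × ℝ) i) × (State d × ℝ) =>
    g z.1 * f z.2 := (hg.comp measurable_fst).mul (hf.comp measurable_snd)
  have h1 := congrArg (fun m => ∫⁻ z, g z.1 * f z.2 ∂m) key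
  rw [lintegral_map hF (by fun_prop), Measure.lintegral_compProd hF, lintegral_map] at h1
  · rw [pathLaw, ← h1]
    refine lintegral_congr fun ω => ?_
    simp only
    rw [lintegral_const_mul _ hf, stepKernel, Kernel.comap_apply, Kernel.lintegral_comp _ _ _ hf]
    rfl
  · exact Measurable.lintegral_kernel_prod_right hF
  · fun_prop

/-- Up to time `k`, the chain has not come back to `x` after its start. -/
def avoidHist (x : State d) (k : ℕ) : Set ((i : Finset.Iic k) → (fun _ : ℕ => State d × ℝ) i) :=
  {h | ∀ i : Finset.Iic k, 1 ≤ i.1 → (h i).1 ≠ x}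

/-- The paths that have not come back to `x` up to time `k`. -/
def avoid (x : State d) (k : ℕ) : Set (ℕ → State d × ℝ) :=
  {ω | ∀ i, 1 ≤ i → i ≤ k → (ω i).1 ≠ x}

lemma measurableSet_avoidHist {x : State d} (hx : MeasurableSet {x}) (k : ℕ) :
    MeasurableSet (avoidHist x k) := by
  have h : avoidHist x k = ⋂ i : Finset.Iic k, ⋂ (_ : 1 ≤ i.1), {h | (h i).1 ≠ x} := by
    ext h
    simp only [avoidHist, Set.mem_iInter, Set.mem_ofPred_eq]
  rw [h]
  refine MeasurableSet.iInter fun i => MeasurableSet.iInter fun _ => ?_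
  exact (measurable_fst.comp (measurable_pi_apply i)) hx.compl

lemma frestrictLe_mem_avoidHist {x : State d} {k : ℕ} {ω : ℕ → State d × ℝ} :
    Preorder.frestrictLe k ω ∈ avoidHist x k ↔ ω ∈ avoid x k :=
  ⟨fun h i h1 hk => h ⟨i, Finset.mem_Iic.2 hk⟩ h1,
    fun h i h1 => h i.1 h1 (Finset.mem_Iic.1 i.2)⟩

lemma measurableSet_avoid {x : State d} (hx : MeasurableSet {x}) (k : ℕ) :
    MeasurableSet (avoid x k) := by
  have h : avoid x k = Preorder.frestrictLe k ⁻¹' avoidHist x k := by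
    ext ω
    exact frestrictLe_mem_avoidHist.symm
  rw [h]
  exact (by fun_prop : Measurable (Preorder.frestrictLe k)) (measurableSet_avoidHist hx k)

lemma avoid_zero (x : State d) : avoid x 0 = Set.univ :=
  Set.eq_univ_of_forall fun _ _ h1 h0 => by omega

lemma avoid_succ_subset (x : State d) (k : ℕ) : avoid x (k + 1) ⊆ avoid x k :=
  fun _ h i h1 hk => h i h1 (hk.trans k.le_succ)

/-- The part of the expectation of `f` at time `k + 1` on which the chain has not come back to `x`
up to time `k` is computed by conditioning on the state at time `k`. -/
lemma setLIntegral_avoid_succ {x : State d} (hx : MeasurableSet {x}) (k : ℕ)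
    {f : State d × ℝ → ℝ≥0∞} (hf : Measurable f) :
    ∫⁻ ω in avoid x k, f (ω (k + 1)) ∂(pathLaw S p x)
      = ∫⁻ ω in avoid x k,
          ∫⁻ y, ∫⁻ z, f z ∂(visitKernel S p y) ∂(jumpKernel S p (ω k).1) ∂(pathLaw S p x) := by
  have h := lintegral_pathLaw_succ (S := S) (p := p) x k
    (g := (avoidHist x k).indicator 1) (measurable_one.indicator (measurableSet_avoidHist hx k)) hf
  have h1 : ∀ F : (ℕ → State d × ℝ) → ℝ≥0∞,
      ∫⁻ ω, (avoidHist x k).indicator 1 (Preorder.frestrictLe k ω) * F ω ∂(pathLaw S p x)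
        = ∫⁻ ω in avoid x k, F ω ∂(pathLaw S p x) := by
    intro F
    rw [← lintegral_indicator (measurableSet_avoid hx k)]
    refine lintegral_congr fun ω => ?_
    by_cases hω : ω ∈ avoid x k
    · rw [Set.indicator_of_mem hω, Set.indicator_of_mem (frestrictLe_mem_avoidHist.2 hω),
        Pi.one_apply, one_mul]
    · rw [Set.indicator_of_notMem hω,
        Set.indicator_of_notMem (mt frestrictLe_mem_avoidHist.1 hω), zero_mul]
  rw [h1, h1] at h
  exact h

/-- The return time is at most the sum of the holding times, each increased by one, before the
return. -/
lemma returnTime_le_tsum (x : State d) (ω : ℕ → State d × ℝ) :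
    returnTime x ω ≤ ∑' k, (avoid x k).indicator (fun ω => ENNReal.ofReal (ω k).2 + 1) ω := by
  classical
  by_cases hret : ∃ k, 1 ≤ k ∧ (ω k).1 = x
  · obtain ⟨hk1, hk⟩ := Nat.find_spec hret
    set k := Nat.find hret with hkdef
    calc returnTime x ω ≤ jumpTime ω k := sInf_le ⟨k, hk1, hk, rfl⟩
      _ ≤ ∑ j ∈ Finset.range k,
            (avoid x j).indicator (fun ω => ENNReal.ofReal (ω j).2 + 1) ω := by
          refine Finset.sum_le_sum fun j hj => ?_
          rw [Set.indicator_of_mem]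
          · exact le_self_add
          · intro i h1 hi hix
            exact Nat.find_min hret (lt_of_le_of_lt hi (Finset.mem_range.1 hj)) ⟨h1, hix⟩
      _ ≤ _ := ENNReal.sum_le_tsum _
  -- On a path that never returns the return time is infinite, and holding times alone might be
  -- summable. The added ones make the right-hand side infinite.
  · push Not at hret
    have h : ∀ k, ω ∈ avoid x k := fun k i h1 _ => hret i h1
    have htop : ∑' _ : ℕ, (1 : ℝ≥0∞) = ⊤ := ENNReal.tsum_const_eq_top_of_ne_zero one_ne_zero
    calc returnTime x ω ≤ ∑' _ : ℕ, (1 : ℝ≥0∞) := by rw [htop]; exact le_top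
      _ ≤ _ := by
        refine ENNReal.tsum_le_tsum fun k => ?_
        rw [Set.indicator_of_mem (h k)]
        exact le_add_self

lemma lintegral_visitKernel_fst {W : State d → ℝ≥0∞} (hW : Measurable W) (y : State d) :
    ∫⁻ z, W z.1 ∂(visitKernel S p y) = W y := by
  have := isProbabilityMeasure_expMeasure (jumpRate_pos S p y)
  rw [lintegral_visitKernel (f := fun z => W z.1) (hW.comp measurable_fst)]
  simp only
  rw [lintegral_const, measure_univ, mul_one]

/-- Foster's criterion: if a nonnegative function of the state decreases on average by `δ` with
each jump out of a state other than `x`, and has finite mean after a jump out of `x`, then `x` is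
positive recurrent. -/
theorem positiveRecurrent_of_drift {x : State d} (hx : MeasurableSet {x}) {W : State d → ℝ≥0∞}
    (hW : Measurable W) {δ : ℝ≥0∞} (hδ : δ ≠ 0) (hδ' : δ ≠ ∞)
    (hdrift : ∀ y ≠ x, ∫⁻ z, W z ∂(jumpKernel S p y) + δ ≤ W y)
    (hstart : ∫⁻ z, W z ∂(jumpKernel S p x) ≠ ∞) : PositiveRecurrent S p x := by
  set P := pathLaw S p x with hP
  set c : ℝ≥0∞ := ENNReal.ofReal (1 / S.lam) + 1 with hc
  have hc_top : c ≠ ∞ := by simp [hc]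
  have h0 : ∀ᵐ ω ∂P, (ω 0).1 = x := by
    have h : ∀ᵐ z ∂(visitKernel S p x), z.1 = x := by
      have hs : MeasurableSet {z : State d × ℝ | z.1 = x}ᶜ := (measurable_fst hx).compl
      change visitKernel S p x {z : State d × ℝ | z.1 = x}ᶜ = 0
      rw [← lintegral_indicator_one hs, lintegral_visitKernel (measurable_one.indicator hs)]
      simp
    rw [← pathLaw_map_zero x] at h
    exact ae_of_ae_map (measurable_pi_apply 0).aemeasurable h
  -- the truncated Lyapunov sequence
  set a : ℕ → ℝ≥0∞ := fun k => ∫⁻ ω in avoid x k, W (ω k).1 ∂P with ha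
  have hstep : ∀ k, a (k + 1)
      ≤ ∫⁻ ω in avoid x k, ∫⁻ y, W y ∂(jumpKernel S p (ω k).1) ∂P := by
    intro k
    calc a (k + 1) ≤ ∫⁻ ω in avoid x k, W (ω (k + 1)).1 ∂P :=
          lintegral_mono_set (avoid_succ_subset x k)
      _ = _ := by
          rw [hP, setLIntegral_avoid_succ hx k (f := fun z => W z.1) (hW.comp measurable_fst)]
          simp_rw [lintegral_visitKernel_fst hW]
  have ha1 : a 1 ≠ ∞ := by
    refine ne_top_of_le_ne_top hstart ((hstep 0).trans ?_)
    rw [avoid_zero, Measure.restrict_univ,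
      lintegral_congr_ae (g := fun _ => ∫⁻ y, W y ∂(jumpKernel S p x))
        (h0.mono fun ω h => by simp only [h]), lintegral_const, measure_univ, mul_one]
  -- The decrease starts at index one: at time zero the chain sits in `x`, where no drift is
  -- assumed.
  have hdec : ∀ k, a (k + 2) + δ * P (avoid x (k + 1)) ≤ a (k + 1) := by
    intro k
    calc a (k + 2) + δ * P (avoid x (k + 1))
        ≤ ∫⁻ ω in avoid x (k + 1), ∫⁻ y, W y ∂(jumpKernel S p (ω (k + 1)).1) ∂P
            + ∫⁻ _ in avoid x (k + 1), δ ∂P := by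
          rw [setLIntegral_const]
          gcongr
          exact hstep (k + 1)
      _ = ∫⁻ ω in avoid x (k + 1), (∫⁻ y, W y ∂(jumpKernel S p (ω (k + 1)).1) + δ) ∂P :=
          (lintegral_add_right _ measurable_const).symm
      _ ≤ a (k + 1) :=
          setLIntegral_mono' (measurableSet_avoid hx _) fun ω hω =>
            hdrift _ (hω (k + 1) (by omega) le_rfl)
  have hsum : ∀ n, a (n + 1) + δ * ∑ k ∈ Finset.range n, P (avoid x (k + 1)) ≤ a 1 := by
    intro n
    induction n with
    | zero => simp
    | succ n ih =>
      rw [Finset.sum_range_succ, mul_add]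
      calc a (n + 2) + (δ * ∑ k ∈ Finset.range n, P (avoid x (k + 1)) + δ * P (avoid x (n + 1)))
          = (a (n + 2) + δ * P (avoid x (n + 1)))
              + δ * ∑ k ∈ Finset.range n, P (avoid x (k + 1)) := by ring
        _ ≤ a (n + 1) + δ * ∑ k ∈ Finset.range n, P (avoid x (k + 1)) := by
            gcongr
            exact hdec n
        _ ≤ a 1 := ih
  -- Telescoping bounds the expected number of jumps before the return by `1 + a 1 / δ`.
  have htsum : ∑' k, P (avoid x k) ≠ ∞ := by
    rw [tsum_eq_zero_add' ENNReal.summable]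
    refine ENNReal.add_ne_top.2 ⟨measure_ne_top _ _, ?_⟩
    refine ne_top_of_le_ne_top (ENNReal.div_ne_top ha1 hδ) (ENNReal.tsum_le_of_sum_range_le fun n => ?_)
    rw [ENNReal.le_div_iff_mul_le (Or.inl hδ) (Or.inl hδ'), mul_comm]
    exact le_add_self.trans (hsum n)
  -- the mean holding times
  have hg : Measurable fun z : State d × ℝ => ENNReal.ofReal z.2 + 1 := by fun_prop
  have hzero : ∫⁻ ω, (ENNReal.ofReal (ω 0).2 + 1) ∂P ≤ c := by
    have h := lintegral_map (μ := P) hg (measurable_pi_apply 0)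
    rw [← h, hP, pathLaw_map_zero]
    exact lintegral_visitKernel_time_le x
  -- Enlarging the event to `avoid x k` makes it depend on the history up to `k` only, so the next
  -- holding time can be integrated out.
  have hterm : ∀ k, ∫⁻ ω in avoid x (k + 1), (ENNReal.ofReal (ω (k + 1)).2 + 1) ∂P
      ≤ c * P (avoid x k) := by
    intro k
    calc ∫⁻ ω in avoid x (k + 1), (ENNReal.ofReal (ω (k + 1)).2 + 1) ∂P
        ≤ ∫⁻ ω in avoid x k, (ENNReal.ofReal (ω (k + 1)).2 + 1) ∂P :=
          lintegral_mono_set (avoid_succ_subset x k)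
      _ = ∫⁻ ω in avoid x k, ∫⁻ y, ∫⁻ z, (ENNReal.ofReal z.2 + 1) ∂(visitKernel S p y)
            ∂(jumpKernel S p (ω k).1) ∂P := setLIntegral_avoid_succ hx k hg
      _ ≤ ∫⁻ _ in avoid x k, c ∂P := by
          refine lintegral_mono fun ω => ?_
          calc ∫⁻ y, ∫⁻ z, (ENNReal.ofReal z.2 + 1) ∂(visitKernel S p y) ∂(jumpKernel S p (ω k).1)
              ≤ ∫⁻ _, c ∂(jumpKernel S p (ω k).1) :=
                lintegral_mono fun y => lintegral_visitKernel_time_le y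
            _ = c := by rw [lintegral_const, measure_univ, mul_one]
      _ = c * P (avoid x k) := setLIntegral_const _ _
  rw [PositiveRecurrent]
  calc ∫⁻ ω, returnTime x ω ∂P
      ≤ ∫⁻ ω, ∑' k, (avoid x k).indicator (fun ω => ENNReal.ofReal (ω k).2 + 1) ω ∂P :=
        lintegral_mono fun ω => returnTime_le_tsum x ω
    _ = ∑' k, ∫⁻ ω in avoid x k, (ENNReal.ofReal (ω k).2 + 1) ∂P := by
        rw [lintegral_tsum fun k => (Measurable.indicator (by fun_prop)
          (measurableSet_avoid hx k)).aemeasurable]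
        exact tsum_congr fun k => lintegral_indicator (measurableSet_avoid hx k) _
    _ ≤ c + ∑' k, c * P (avoid x k) := by
        rw [tsum_eq_zero_add' ENNReal.summable, avoid_zero, Measure.restrict_univ]
        exact add_le_add hzero (ENNReal.tsum_le_tsum hterm)
    _ < ∞ := by
        rw [ENNReal.tsum_mul_left]
        exact (ENNReal.add_ne_top.2 ⟨hc_top, ENNReal.mul_ne_top hc_top htsum⟩).lt_top

end MRJ
end

noncomputable section

namespace MRJ

/-! ## Type counts -/

variable {d : ℕ}

/-- The type is read off coordinatewise as `⌈v_l K_l⌉`; positivity of `v_l` makes it at least one.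
-/
lemma exists_unique_bucket {K : Fin d → ℕ} (hK : ∀ l, 0 < K l) (v : Req d) :
    ∃! i : JobType K, v ∈ bucket K i := by
  have hK' : ∀ l, (0 : ℝ) < K l := fun l => Nat.cast_pos.2 (hK l)
  have key : ∀ (l : Fin d) (m : ℕ), 1 ≤ m →
      ((((m : ℝ) - 1) / K l < v.1 l ∧ v.1 l ≤ (m : ℝ) / K l) ↔ ⌈v.1 l * K l⌉₊ = m) := by
    intro l m hm
    rw [Nat.ceil_eq_iff (by omega), div_lt_iff₀ (hK' l), le_div_iff₀ (hK' l), Nat.cast_sub hm,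
      Nat.cast_one]
  have hpos : ∀ l, 1 ≤ ⌈v.1 l * K l⌉₊ := fun l =>
    Nat.one_le_ceil_iff.2 (mul_pos (v.2 l).1 (hK' l))
  refine ⟨⟨fun l => ⌈v.1 l * K l⌉₊, Finset.mem_Icc.2 ⟨hpos, fun l => ?_⟩⟩, fun l => ?_, ?_⟩
  · refine Nat.ceil_le.2 ?_
    have := mul_le_mul_of_nonneg_right (v.2 l).2 (hK' l).le
    rwa [one_mul] at this
  · exact (key l _ (hpos l)).2 rfl
  · intro i hi
    refine Subtype.ext (funext fun l => ?_)
    exact ((key l _ ((Finset.mem_Icc.1 i.2).1 l)).1 (hi l)).symm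

lemma sum_indicator_bucket {K : Fin d → ℕ} (hK : ∀ l, 0 < K l) (v : Req d) :
    ∑ i : JobType K, (bucket K i).indicator (1 : Req d → ℝ) v = 1 := by
  obtain ⟨i, hi, hu⟩ := exists_unique_bucket hK v
  rw [Finset.sum_eq_single i]
  · rw [Set.indicator_of_mem hi, Pi.one_apply]
  · exact fun j _ hj => Set.indicator_of_notMem (fun h => hj (hu j h)) _
  · exact fun h => absurd (Finset.mem_univ i) h

lemma measurableSet_bucket (K : Fin d → ℕ) (i : JobType K) : MeasurableSet (bucket K i) := by
  have h : bucket K i = ⋂ l, {v : Req d | ((i.1 l : ℝ) - 1) / K l < v.1 l}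
      ∩ {v : Req d | v.1 l ≤ (i.1 l : ℝ) / K l} := by
    ext v
    simp [bucket]
  rw [h]
  have hm : ∀ l, Measurable fun v : Req d => v.1 l := fun l =>
    (measurable_pi_apply l).comp measurable_subtype_coe
  exact MeasurableSet.iInter fun l =>
    (measurableSet_lt measurable_const (hm l)).inter (measurableSet_le (hm l) measurable_const)

lemma typeCount_eq_sum (K : Fin d → ℕ) (x : State d) (s : Finset (Fin x.1)) (i : JobType K) :
    (typeCount K x s i : ℝ) = ∑ n ∈ s, (bucket K i).indicator (1 : Req d → ℝ) (x.2 n) := by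
  classical
  rw [typeCount, Finset.card_filter, Nat.cast_sum]
  refine Finset.sum_congr rfl fun n _ => ?_
  by_cases h : x.2 n ∈ bucket K i <;> simp [h]

lemma sum_typeCount {K : Fin d → ℕ} (hK : ∀ l, 0 < K l) (x : State d) (s : Finset (Fin x.1)) :
    ∑ i, typeCount K x s i = s.card := by
  have h : ((∑ i, typeCount K x s i : ℕ) : ℝ) = s.card := by
    push_cast
    simp_rw [typeCount_eq_sum]
    rw [Finset.sum_comm, Finset.sum_congr rfl fun n _ => sum_indicator_bucket hK (x.2 n),
      Finset.sum_const, nsmul_one]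
  exact_mod_cast h

lemma sum_queue {K : Fin d → ℕ} (hK : ∀ l, 0 < K l) (x : State d) :
    ∑ i, queue K x i = x.1 := by
  have h := sum_typeCount hK x Finset.univ
  rwa [Finset.card_univ, Fintype.card_fin] at h

lemma queue_arrive (K : Fin d → ℕ) (x : State d) (w : Req d) (i : JobType K) :
    (queue K (arrive x w) i : ℝ) = queue K x i + (bucket K i).indicator (1 : Req d → ℝ) w := by
  rw [queue, queue, typeCount_eq_sum, typeCount_eq_sum]
  change ∑ n : Fin (x.1 + 1), _ = _
  rw [Fin.sum_univ_castSucc]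
  simp [arrive]

lemma depart_fst (x : State d) (n : Fin x.1) : (depart x n).1 + 1 = x.1 := by
  obtain ⟨N, v⟩ := x
  cases N with
  | zero => exact n.elim0
  | succ N => rfl

lemma queue_depart (K : Fin d → ℕ) (x : State d) (n : Fin x.1) (i : JobType K) :
    (queue K (depart x n) i : ℝ)
      = queue K x i - (bucket K i).indicator (1 : Req d → ℝ) (x.2 n) := by
  obtain ⟨N, v⟩ := x
  cases N with
  | zero => exact n.elim0
  | succ N =>
    have h : (∑ m : Fin (N + 1), (bucket K i).indicator (1 : Req d → ℝ) (v m)) = _ :=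
      Fin.sum_univ_succAbove _ n
    rw [queue, queue, typeCount_eq_sum, typeCount_eq_sum, h, add_sub_cancel_left]
    rfl

lemma measurable_queue (K : Fin d → ℕ) (i : JobType K) :
    Measurable fun x : State d => (queue K x i : ℝ) := by
  refine (measurable_state_iff _).2 fun N => ?_
  simp_rw [queue, typeCount_eq_sum]
  have hm : Measurable ((bucket K i).indicator (1 : Req d → ℝ)) :=
    measurable_one.indicator (measurableSet_bucket K i)
  refine Finset.measurable_sum Finset.univ fun n _ => ?_
  exact hm.comp (measurable_pi_apply n)

lemma eq_emptyState_iff (x : State d) : x = emptyState d ↔ x.1 = 0 := by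
  refine ⟨fun h => by rw [h]; rfl, fun h => ?_⟩
  obtain ⟨N, v⟩ := x
  subst h
  exact congrArg (fun v => (⟨0, v⟩ : State d)) (Subsingleton.elim v Fin.elim0)

lemma measurable_jobCount : Measurable fun x : State d => x.1 :=
  (measurable_state_iff _).2 fun _ => measurable_const

lemma measurableSet_emptyState : MeasurableSet {emptyState d} := by
  have h : {emptyState d} = (fun x : State d => x.1) ⁻¹' {0} := by
    ext x
    simp [eq_emptyState_iff]
  rw [h]
  exact measurable_jobCount (measurableSet_singleton 0)

/-! ## Arrival and service measures -/

lemma arrivalMeasure_eq (S : Model d) (K : Fin d → ℕ) (i : JobType K) :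
    arrivalMeasure S K i = S.lam * S.reqLaw.real (bucket K i) := by
  rw [arrivalMeasure, integral_const_mul, Measure.real, Model.reqLaw,
    withDensity_apply _ (measurableSet_bucket K i),
    integral_eq_lintegral_of_nonneg_ae (ae_of_all _ S.density_nonneg)
      S.measurable_density.aestronglyMeasurable]

/-- Each job of type `i` occupies `i_l ≥ 1` units of resource `l`. One coordinate thus bounds the
number of jobs in service, which is where `d ≥ 1` enters. -/
lemma sum_option_le {K : Fin d → ℕ} {M : JobType K → ℕ} (hM : M ∈ serviceOptions K) (l : Fin d) :
    ∑ i, M i ≤ K l :=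
  (Finset.sum_le_sum fun i _ =>
    Nat.le_mul_of_pos_left (M i) ((Finset.mem_Icc.1 i.2).1 l : 1 ≤ i.1 l)).trans (hM l)

lemma finite_serviceOptions (hd : 0 < d) (K : Fin d → ℕ) : (serviceOptions K).Finite :=
  (Set.finite_Iic (fun _ : JobType K => K ⟨0, hd⟩)).subset fun _ hM i =>
    (Finset.single_le_sum (fun _ _ => Nat.zero_le _) (Finset.mem_univ i)).trans
      (sum_option_le hM ⟨0, hd⟩)

/-- A MaxWeight choice has at least the mean weight of any distribution on the efficient set. -/
lemma sum_serviceMeasure_mul_le (hd : 0 < d) {K : Fin d → ℕ} {E : Set (JobType K → ℕ)}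
    {β : PMF (serviceOptions K)} (hβ : ∀ M ∈ β.support, M.1 ∈ E) {q M₀ : JobType K → ℕ}
    (hmax : ∀ M ∈ E, weight M q ≤ weight M₀ q) :
    ∑ i, serviceMeasure β i * q i ≤ weight M₀ q := by
  have := (finite_serviceOptions hd K).fintype
  have hsum : ∑ M, (β M).toReal = 1 := by
    have h := β.tsum_coe
    rw [tsum_fintype] at h
    rw [← ENNReal.toReal_sum fun M _ => β.apply_ne_top M, h, ENNReal.toReal_one]
  calc ∑ i, serviceMeasure β i * q i = ∑ M : serviceOptions K, (β M).toReal * weight M.1 q := by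
        simp_rw [serviceMeasure, tsum_fintype, weight, Finset.sum_mul]
        rw [Finset.sum_comm]
        refine Finset.sum_congr rfl fun M _ => ?_
        push_cast
        rw [Finset.mul_sum]
        exact Finset.sum_congr rfl fun i _ => mul_assoc _ _ _
    _ ≤ ∑ M : serviceOptions K, (β M).toReal * weight M₀ q := by
        refine Finset.sum_le_sum fun M _ => ?_
        -- Options off the support may lie outside `E`, but they carry no mass.
        by_cases hM : M ∈ β.support
        · exact mul_le_mul_of_nonneg_left (Nat.cast_le.2 (hmax _ (hβ M hM))) ENNReal.toReal_nonneg
        · rw [(β.apply_eq_zero_iff M).2 hM]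
          simp
    _ = weight M₀ q := by rw [← Finset.sum_mul, hsum, one_mul]

/-! ## The generator and the Lyapunov function -/

lemma lintegral_jumpKernel (S : Model d) (p : Policy d) {f : State d → ℝ} (hf : Measurable f)
    (hf0 : ∀ x, 0 ≤ f x) (x : State d) (hi : Integrable (fun w => f (arrive x w)) S.reqLaw) :
    ∫⁻ y, ENNReal.ofReal (f y) ∂(jumpKernel S p x)
      = ENNReal.ofReal ((S.lam * ∫ w, f (arrive x w) ∂S.reqLaw
          + ∑ n ∈ p.served x, f (depart x n)) / jumpRate S p x) := by
  have hr := jumpRate_pos S p x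
  have hF : Measurable fun y => ENNReal.ofReal (f y) := hf.ennreal_ofReal
  change ∫⁻ y, ENNReal.ofReal (f y) ∂(jumpLaw S p x) = _
  rw [jumpLaw, lintegral_add_measure, lintegral_smul_measure, lintegral_map hF (measurable_arrive x),
    lintegral_finsetSum_measure, ← ofReal_integral_eq_lintegral_ofReal hi (ae_of_all _ fun w => hf0 _)]
  simp_rw [lintegral_smul_measure, lintegral_dirac' _ hF, smul_eq_mul]
  have h1 : 0 ≤ ∫ w, f (arrive x w) ∂S.reqLaw := integral_nonneg fun w => hf0 _
  have h2 : ∀ n, 0 ≤ 1 / jumpRate S p x * f (depart x n) := fun n =>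
    mul_nonneg (by positivity) (hf0 _)
  simp_rw [← ENNReal.ofReal_mul (one_div_nonneg.2 hr.le)]
  rw [← ENNReal.ofReal_mul (div_nonneg S.lam_pos.le hr.le),
    ← ENNReal.ofReal_sum_of_nonneg fun n _ => h2 n,
    ← ENNReal.ofReal_add (mul_nonneg (div_nonneg S.lam_pos.le hr.le) h1)
      (Finset.sum_nonneg fun n _ => h2 n), ← Finset.mul_sum]
  congr 1
  field_simp

/-- The sum of the squared type counts, plus a bounded concave increasing function of the number
of jobs. -/
def lyapunov (K : Fin d → ℕ) (A r : ℝ) (x : State d) : ℝ :=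
  ∑ i, (queue K x i : ℝ) ^ 2 + A * ∑ j ∈ Finset.range x.1, r ^ (j + 1)

variable {K : Fin d → ℕ} {A r : ℝ}

lemma lyapunov_nonneg (hA : 0 ≤ A) (hr : 0 ≤ r) (x : State d) : 0 ≤ lyapunov K A r x := by
  unfold lyapunov
  positivity

lemma measurable_lyapunov : Measurable (lyapunov K A r (d := d)) := by
  refine Measurable.add (Finset.measurable_sum _ fun i _ => (measurable_queue K i).pow_const 2) ?_
  exact ((measurable_from_top (f := fun N : ℕ => ∑ j ∈ Finset.range N, r ^ (j + 1))).comp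
    measurable_jobCount).const_mul A

lemma lyapunov_arrive (x : State d) (w : Req d) :
    lyapunov K A r (arrive x w) = lyapunov K A r x
      + ∑ i, (bucket K i).indicator (1 : Req d → ℝ) w * (2 * queue K x i + 1)
      + A * r ^ (x.1 + 1) := by
  have h : ∑ i, (queue K (arrive x w) i : ℝ) ^ 2 = ∑ i, (queue K x i : ℝ) ^ 2
      + ∑ i, (bucket K i).indicator (1 : Req d → ℝ) w * (2 * queue K x i + 1) := by
    rw [← Finset.sum_add_distrib]
    refine Finset.sum_congr rfl fun i _ => ?_
    rw [queue_arrive]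
    by_cases hw : w ∈ bucket K i
    · simp only [Set.indicator_of_mem hw, Pi.one_apply]
      ring
    · simp only [Set.indicator_of_notMem hw]
      ring
  have hN : (arrive x w).1 = x.1 + 1 := rfl
  rw [lyapunov, lyapunov, h, hN, Finset.sum_range_succ]
  ring

/-- A squared count changes by `(q - 1) ^ 2 - q ^ 2 = 1 - 2 q`, and the geometric sum loses its last
term `r ^ N`. -/
lemma lyapunov_depart (x : State d) (n : Fin x.1) :
    lyapunov K A r (depart x n) = lyapunov K A r x
      + ∑ i, (bucket K i).indicator (1 : Req d → ℝ) (x.2 n) * (1 - 2 * queue K x i)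
      - A * r ^ x.1 := by
  have h : ∑ i, (queue K (depart x n) i : ℝ) ^ 2 = ∑ i, (queue K x i : ℝ) ^ 2
      + ∑ i, (bucket K i).indicator (1 : Req d → ℝ) (x.2 n) * (1 - 2 * queue K x i) := by
    rw [← Finset.sum_add_distrib]
    refine Finset.sum_congr rfl fun i _ => ?_
    rw [queue_depart]
    by_cases hw : x.2 n ∈ bucket K i
    · simp only [Set.indicator_of_mem hw, Pi.one_apply]
      ring
    · simp only [Set.indicator_of_notMem hw]
      ring
  have hN := depart_fst x n
  rw [lyapunov, lyapunov, h, ← hN, Finset.sum_range_succ]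
  ring

/-! ### Mean of the Lyapunov function after one jump -/

lemma integrable_indicator_bucket (S : Model d) (i : JobType K) :
    Integrable ((bucket K i).indicator (1 : Req d → ℝ)) S.reqLaw :=
  (integrable_const (1 : ℝ)).indicator (measurableSet_bucket K i)

lemma integrable_lyapunov_arrive (S : Model d) (x : State d) :
    Integrable (fun w => lyapunov K A r (arrive x w)) S.reqLaw := by
  simp_rw [lyapunov_arrive]
  exact ((integrable_const _).add (integrable_finsetSum _ fun i _ =>
    (integrable_indicator_bucket S i).mul_const _)).add (integrable_const _)

lemma integral_lyapunov_arrive (S : Model d) (x : State d) :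
    S.lam * ∫ w, lyapunov K A r (arrive x w) ∂S.reqLaw
      = S.lam * lyapunov K A r x + ∑ i, arrivalMeasure S K i * (2 * queue K x i + 1)
        + S.lam * (A * r ^ (x.1 + 1)) := by
  have hint := fun i : JobType K =>
    (integrable_indicator_bucket S i).mul_const (2 * (queue K x i : ℝ) + 1)
  have hsum := integrable_finsetSum Finset.univ fun i _ => hint i
  have hcs : Integrable (fun w => lyapunov K A r x
      + ∑ i, (bucket K i).indicator (1 : Req d → ℝ) w * (2 * queue K x i + 1)) S.reqLaw :=
    (integrable_const _).add hsum
  simp_rw [lyapunov_arrive]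
  rw [integral_add hcs (integrable_const _),
    integral_add (integrable_const _) hsum, integral_finsetSum _ fun i _ => hint i]
  simp_rw [integral_mul_const, integral_indicator_one (measurableSet_bucket K _),
    arrivalMeasure_eq, integral_const, probReal_univ, one_smul]
  rw [mul_add, mul_add, Finset.mul_sum]
  simp_rw [mul_assoc]

/-- The action of the generator on the Lyapunov function. -/
def drift (S : Model d) (p : Policy d) (K : Fin d → ℕ) (A r : ℝ) (x : State d) : ℝ :=
  ∑ i, arrivalMeasure S K i * (2 * queue K x i + 1)
    + ∑ i, (typeCount K x (p.served x) i : ℝ) * (1 - 2 * queue K x i)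
    + A * (S.lam * r ^ (x.1 + 1) - (p.served x).card * r ^ x.1)

lemma mean_lyapunov_after_jump (S : Model d) (p : Policy d) (x : State d) :
    (S.lam * ∫ w, lyapunov K A r (arrive x w) ∂S.reqLaw
        + ∑ n ∈ p.served x, lyapunov K A r (depart x n)) / jumpRate S p x
      = lyapunov K A r x + drift S p K A r x / jumpRate S p x := by
  have hR := (jumpRate_pos S p x).ne'
  have h : ∑ n ∈ p.served x, lyapunov K A r (depart x n)
      = (p.served x).card * lyapunov K A r x
        + ∑ i, (typeCount K x (p.served x) i : ℝ) * (1 - 2 * queue K x i)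
        - (p.served x).card * (A * r ^ x.1) := by
    simp_rw [lyapunov_depart, typeCount_eq_sum, Finset.sum_mul]
    rw [Finset.sum_sub_distrib, Finset.sum_add_distrib, Finset.sum_comm]
    simp
  rw [integral_lyapunov_arrive, h, div_eq_iff hR, add_mul, div_mul_cancel₀ _ hR, drift, jumpRate]
  ring

lemma lintegral_lyapunov_jumpKernel (S : Model d) (p : Policy d) (hA : 0 ≤ A) (hr : 0 ≤ r)
    (x : State d) :
    ∫⁻ y, ENNReal.ofReal (lyapunov K A r y) ∂(jumpKernel S p x)
      = ENNReal.ofReal (lyapunov K A r x + drift S p K A r x / jumpRate S p x) := by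
  rw [lintegral_jumpKernel S p measurable_lyapunov (lyapunov_nonneg hA hr) x
    (integrable_lyapunov_arrive S x), mean_lyapunov_after_jump]

/-- Foster's criterion for the Lyapunov function, in terms of the generator. -/
lemma isStable_of_drift_le {S : Model d} {p : Policy d} (hA : 0 ≤ A) (hr : 0 ≤ r) {b : ℝ}
    (hb : 0 ≤ b) (hcard : ∀ x, ((p.served x).card : ℝ) ≤ b)
    (hdrift : ∀ x : State d, 0 < x.1 → drift S p K A r x ≤ -1) : IsStable S p := by
  have hlb : 0 < S.lam + b := add_pos_of_pos_of_nonneg S.lam_pos hb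
  refine positiveRecurrent_of_drift measurableSet_emptyState
    (W := fun x => ENNReal.ofReal (lyapunov K A r x)) measurable_lyapunov.ennreal_ofReal
    -- The jump chain drifts by the generator value divided by the jump rate, and that rate is at
    -- most `λ + b`.
    (δ := ENNReal.ofReal (1 / (S.lam + b))) (by simpa using hlb) ENNReal.ofReal_ne_top
    (fun x hx => ?_) ?_
  · have hR := jumpRate_pos S p x
    have hle : jumpRate S p x ≤ S.lam + b := add_le_add le_rfl (hcard x)
    have hN : 0 < x.1 := Nat.pos_of_ne_zero fun h => hx ((eq_emptyState_iff x).2 h)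
    have hinv : 1 / (S.lam + b) ≤ 1 / jumpRate S p x := one_div_le_one_div_of_le hR hle
    have hd : drift S p K A r x / jumpRate S p x ≤ -1 / jumpRate S p x :=
      div_le_div_of_nonneg_right (hdrift x hN) hR.le
    rw [neg_div] at hd
    -- As a mean of nonnegative values this is nonnegative, so `ENNReal.ofReal` does not truncate
    -- and is additive here.
    have h0 : 0 ≤ lyapunov K A r x + drift S p K A r x / jumpRate S p x := by
      rw [← mean_lyapunov_after_jump]
      exact div_nonneg (add_nonneg
        (mul_nonneg S.lam_pos.le (integral_nonneg fun _ => lyapunov_nonneg hA hr _))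
        (Finset.sum_nonneg fun _ _ => lyapunov_nonneg hA hr _)) hR.le
    rw [lintegral_lyapunov_jumpKernel S p hA hr, ← ENNReal.ofReal_add h0 (by positivity)]
    exact ENNReal.ofReal_le_ofReal (by linarith)
  · rw [lintegral_lyapunov_jumpKernel S p hA hr]
    exact ENNReal.ofReal_ne_top

/-- The drift bound for a MaxWeight choice `M` at type counts `q`, without the term that depends
on the number of jobs. -/
lemma quadratic_drift_le {ι : Type*} [Fintype ι] {a η : ι → ℝ} {q M : ι → ℕ} {b : ℕ} {ε : ℝ}
    (ha : ∀ i, a i + ε ≤ η i) (hM : ∑ i, M i ≤ b)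
    (hmax : ∑ i, η i * q i ≤ ((∑ i, M i * q i : ℕ) : ℝ)) :
    ∑ i, a i * (2 * q i + 1) + ∑ i, ((min (M i) (q i) : ℕ) : ℝ) * (1 - 2 * q i)
      ≤ ∑ i, a i + b + 2 * b ^ 2 - 2 * ε * ∑ i, (q i : ℝ) := by
  -- Unused service costs little: it occurs only when `q i ≤ M i ≤ b`, and then the loss `2 q (M -
  -- q)` is at most `2 b M`.
  have h1 : ∀ i, ((min (M i) (q i) : ℕ) : ℝ) * (1 - 2 * q i)
      ≤ M i - 2 * (M i * q i) + 2 * b * M i := by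
    intro i
    have hb : (M i : ℝ) ≤ b := by
      exact_mod_cast (Finset.single_le_sum (fun _ _ => Nat.zero_le _) (Finset.mem_univ i)).trans hM
    have hM0 : (0 : ℝ) ≤ M i := Nat.cast_nonneg _
    have hq0 : (0 : ℝ) ≤ q i := Nat.cast_nonneg _
    rcases le_total (M i) (q i) with h | h
    · rw [min_eq_left h]
      nlinarith
    · rw [min_eq_right h]
      have h' : (q i : ℝ) ≤ M i := Nat.cast_le.2 h
      nlinarith [mul_nonneg hq0 (sub_nonneg.2 h'), mul_le_mul h' hb hM0 hM0,
        mul_le_mul_of_nonneg_left hb hM0]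
  have h2 : ∑ i, ((min (M i) (q i) : ℕ) : ℝ) * (1 - 2 * q i)
      ≤ (1 + 2 * b) * ∑ i, (M i : ℝ) - 2 * ∑ i, (M i : ℝ) * q i := by
    refine (Finset.sum_le_sum fun i _ => h1 i).trans (le_of_eq ?_)
    rw [Finset.sum_add_distrib, Finset.sum_sub_distrib, Finset.mul_sum, Finset.mul_sum,
      ← Finset.mul_sum, ← Finset.mul_sum, ← Finset.mul_sum]
    ring
  have h3 : ∑ i, a i * (2 * q i + 1) ≤ ∑ i, a i + 2 * ∑ i, η i * q i - 2 * ε * ∑ i, (q i : ℝ) := by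
    rw [Finset.mul_sum, Finset.mul_sum, ← Finset.sum_add_distrib, ← Finset.sum_sub_distrib]
    refine Finset.sum_le_sum fun i _ => ?_
    nlinarith [mul_le_mul_of_nonneg_right (ha i) (Nat.cast_nonneg (α := ℝ) (q i))]
  have hM' : ∑ i, (M i : ℝ) ≤ b := by exact_mod_cast hM
  have h4 : (1 + 2 * (b : ℝ)) * ∑ i, (M i : ℝ) ≤ (1 + 2 * b) * b :=
    mul_le_mul_of_nonneg_left hM' (by positivity)
  push_cast at hmax
  nlinarith

/-- The constants are chosen in the order `ε`, `C`, `B`, `r`, `A`: the quadratic drift handles `N ≥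
B` and the geometric term handles `0 < N < B`. -/
theorem isStable_of_isEMW (hd : 0 < d) (S : Model d) (hK : ∀ l, 0 < K l)
    {E : Set (JobType K → ℕ)} (hE : E ⊆ serviceOptions K) {β : PMF (serviceOptions K)}
    (hβ : ∀ M ∈ β.support, M.1 ∈ E) (hη : ∀ i, arrivalMeasure S K i < serviceMeasure β i)
    {p : Policy d} (hp : IsEMW K E p) : IsStable S p := by
  obtain ⟨M, hM, hserved⟩ := hp
  set b := K ⟨0, hd⟩
  have ha0 : ∀ i, 0 ≤ arrivalMeasure S K i := fun i => by
    rw [arrivalMeasure_eq]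
    exact mul_nonneg S.lam_pos.le measureReal_nonneg
  have hMb : ∀ q, ∑ i, M q i ≤ b := fun q => sum_option_le (hE (hM q).1) _
  have hmax : ∀ q : JobType K → ℕ, ∑ i, serviceMeasure β i * q i ≤ weight (M q) q :=
    fun q => sum_serviceMeasure_mul_le hd hβ (hM q).2
  have hcard : ∀ x, (p.served x).card = ∑ i, min (M (queue K x) i) (queue K x i) := fun x => by
    rw [← sum_typeCount hK]
    exact Finset.sum_congr rfl fun i _ => hserved x i
  have hcard_pos : ∀ x : State d, 0 < x.1 → 1 ≤ (p.served x).card := by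
    intro x hx
    rw [← sum_queue hK x, Finset.sum_pos_iff] at hx
    obtain ⟨i, hi, hqi⟩ := hx
    -- Positive weight yields a type that is both present and offered service.
    have hw : (0 : ℝ) < weight (M (queue K x)) (queue K x) := by
      refine lt_of_lt_of_le ?_ (hmax (queue K x))
      have hpos : ∀ j, 0 < serviceMeasure β j := fun j => (ha0 j).trans_lt (hη j)
      exact Finset.sum_pos' (fun j _ => mul_nonneg (hpos j).le (Nat.cast_nonneg _))
        ⟨i, hi, mul_pos (hpos i) (Nat.cast_pos.2 hqi)⟩
    rw [Nat.cast_pos, weight, Finset.sum_pos_iff] at hw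
    obtain ⟨j, hj, hj'⟩ := hw
    rw [hcard, Nat.one_le_iff_ne_zero, ← Nat.pos_iff_ne_zero, Finset.sum_pos_iff]
    exact ⟨j, hj, lt_min (Nat.pos_of_mul_pos_right hj') (Nat.pos_of_mul_pos_left hj')⟩
  -- The smallest slack over the finitely many types; the all-ones type shows there is one.
  obtain ⟨ε, hε, hεη⟩ : ∃ ε > 0, ∀ i, arrivalMeasure S K i + ε ≤ serviceMeasure β i := by
    have hne : (Finset.univ : Finset (JobType K)).Nonempty :=
      ⟨⟨1, Finset.mem_Icc.2 ⟨le_rfl, fun l => hK l⟩⟩, Finset.mem_univ _⟩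
    refine ⟨Finset.univ.inf' hne fun i => serviceMeasure β i - arrivalMeasure S K i,
      (Finset.lt_inf'_iff hne).2 fun i _ => sub_pos.2 (hη i), fun i => ?_⟩
    have := Finset.inf'_le (fun i => serviceMeasure β i - arrivalMeasure S K i) (Finset.mem_univ i)
    linarith
  set C : ℝ := ∑ i, arrivalMeasure S K i + b + 2 * b ^ 2 with hC
  have hC0 : 0 ≤ C := add_nonneg (add_nonneg (Finset.sum_nonneg fun i _ => ha0 i)
    (Nat.cast_nonneg _)) (by positivity)
  obtain ⟨B, hB⟩ := exists_nat_ge ((C + 1) / (2 * ε))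
  rw [div_le_iff₀ (by positivity)] at hB
  have hlam := S.lam_pos
  -- With this `r`, an arrival's gain `λ r ^ (N + 1)` is at most half of the `r ^ N` removed by one
  -- served job.
  set r : ℝ := 1 / (2 * S.lam + 1) with hr
  have hr0 : 0 < r := by positivity
  have hr1 : r ≤ 1 := by
    rw [hr, div_le_one (by positivity)]
    linarith
  have hlr : S.lam * r ≤ 1 / 2 := by
    rw [hr, mul_one_div, div_le_div_iff₀ (by positivity) two_pos]
    linarith
  -- This `A` gives `A r ^ N / 2 ≥ C + 1` whenever `N < B`.
  refine isStable_of_drift_le (K := K) (A := 2 * (C + 1) / r ^ B) (r := r) (b := b)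
    (by positivity) hr0.le (Nat.cast_nonneg _) (fun x => ?_) fun x hx => ?_
  · rw [hcard]
    exact_mod_cast (Finset.sum_le_sum fun i _ => min_le_left _ _).trans (hMb (queue K x))
  · have hquad := quadratic_drift_le (b := b) hεη (hMb (queue K x)) (hmax (queue K x))
    have hsum : ∑ i, (queue K x i : ℝ) = x.1 := by exact_mod_cast sum_queue hK x
    rw [hsum, ← hC] at hquad
    have hk : (1 : ℝ) ≤ (p.served x).card := by exact_mod_cast hcard_pos x hx
    have hpow : 0 < r ^ x.1 := by positivity
    have hbonus : S.lam * r ^ (x.1 + 1) - (p.served x).card * r ^ x.1 ≤ -(r ^ x.1 / 2) := by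
      rw [pow_succ]
      nlinarith [mul_le_mul_of_nonneg_right hlr hpow.le, mul_le_mul_of_nonneg_right hk hpow.le]
    have hA := mul_le_mul_of_nonneg_left hbonus (by positivity : 0 ≤ 2 * (C + 1) / r ^ B)
    have hA' : 2 * (C + 1) / r ^ B * -(r ^ x.1 / 2) = -((C + 1) * (r ^ x.1 / r ^ B)) := by
      field_simp
    rw [hA'] at hA
    simp_rw [drift, hserved]
    rcases le_or_gt B x.1 with hBx | hBx
    · have h1 : 0 ≤ (C + 1) * (r ^ x.1 / r ^ B) := by positivity
      have h2 : (B : ℝ) * (2 * ε) ≤ x.1 * (2 * ε) :=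
        mul_le_mul_of_nonneg_right (Nat.cast_le.2 hBx) (by positivity)
      linarith
    · have h1 : 1 ≤ r ^ x.1 / r ^ B :=
        (one_le_div (by positivity)).2 (pow_le_pow_of_le_one hr0.le hr1 hBx.le)
      have h2 : C + 1 ≤ (C + 1) * (r ^ x.1 / r ^ B) := le_mul_of_one_le_right (by linarith) h1
      have h3 : 0 ≤ 2 * ε * (x.1 : ℝ) := by positivity
      linarith

end MRJ

end

theorem mainTheorem7 {d : ℕ} (hd : 0 < d) (S : MRJ.Model d) (K : Fin d → ℕ)
    (hK : ∀ l, 0 < K l) :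
    ((∃ β : PMF (MRJ.serviceOptions K),
        ∀ i, MRJ.arrivalMeasure S K i < MRJ.serviceMeasure β i) →
      ∀ p : MRJ.Policy d, MRJ.IsMW K p → MRJ.IsStable S p) ∧
    (∀ E : Set (MRJ.JobType K → ℕ), E ⊆ MRJ.serviceOptions K →
      (∃ β : PMF (MRJ.serviceOptions K), (∀ M ∈ β.support, M.1 ∈ E) ∧
        ∀ i, MRJ.arrivalMeasure S K i < MRJ.serviceMeasure β i) →
      ∀ p : MRJ.Policy d, MRJ.IsEMW K E p → MRJ.IsStable S p) := by
  refine ⟨?_, ?_⟩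
  -- MaxWeight is the case where the efficient set is all of `C_K`, so the support condition is
  -- automatic.
  · rintro ⟨β, hη⟩ p hp
    exact MRJ.isStable_of_isEMW hd S hK subset_rfl (fun M _ => M.2) hη hp
  · rintro E hE ⟨β, hβ, hη⟩ p hp
    exact MRJ.isStable_of_isEMW hd S hK hE hβ hη hp
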